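/- **Theorem 4.1 (OhyamaWronskian).** The Ohyama polynomials $\rho_n(s)$, $n\in\mathbb Z$, are the polynomials determined by $\rho_0=\rho_{1}=\rho_{-1}=1$ and the recursion, for all $n\in\mathbb Z$, $$(s+n)\rho_n^2-2s\,\rho_n\ddot\rho_n+2s\,\dot\rho_n^{\,2}-2\rho_n\dot\rho_n=\begin{cases}\rho_{n+1}\rho_{n-1}, & n \text{ odd},\\ s\,\rho_{n+1}\rho_{n-1}, & n\text{ even},\end{cases}$$ where dots denote derivatives in $s$; exactly one sequence of polynomials satisfies these conditions. Moreover, there is exactly one family of real numbers $A_{m,k}$ $(m,k\in\mathbb Z)$, non-zero only if $m,k\ge 0$, such that $$\frac{k+1}{3}A_{m,k+1}-A_{m,k}+\frac{3\sqrt3}{k}A_{m-1,k-2}=0\qquad(m,k\in\mathbb Z,\ k\ne 0),$$ $$A_{m,2m}=\Big(\frac{3\sqrt3}{2}\Big)^m\frac{3^{1/4}}{m!}\ (m\ge 0),\qquad A_{m,0}=0\ (m\ge1),\qquad A_{0,k}=0\ (k\ge1).$$ Let $s=3(z/2)^{2/3}$ for $z\in\mathbb C\setminus(-\infty,0]$,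 with principal branches of all powers. For $n\in\mathbb Z\setminus\{0\}$ put $\operatorname{sgn}(n)=\pm1$ and $$W_n=\sum_{k=0}^{2|n|-2}A_{|n|-1,k}\Big(\frac{\operatorname{sgn}(n)\,s}{3}\Big)^k .$$ Then, for every $n\in\mathbb Z$, with $\delta=\operatorname{sgn}(n)$, $$\rho_n(s)=\begin{cases}3^{-1/4}\left(\dfrac s3\right)^{\frac{|n|-1}{4}}\,Wr(W_{\delta},W_{2\delta},\dots,W_n), & n\text{ odd},\\[2mm] \left(\dfrac s3\right)^{\frac{|n|}{4}}\,Wr(W_{\delta},W_{2\delta},\dots,W_n), & n\text{ even},\end{cases}$$ where $Wr(f_1,\dots,f_N)=\det\big(\tfrac{d^{\,i-1}f_j}{dz^{\,i-1}}\big)_{i,j=1}^N$ is the Wronskian in the variable $z$ (equal to $1$ for $N=0$, i.e. $n=0$). -/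

import Mathlib

open Polynomial

namespace Ohyama

/-- The bilinear differential expression
`(s + n) ρ² - 2 s ρ ρ'' + 2 s (ρ')² - 2 ρ ρ'` (derivatives in `s`), as a polynomial in `s`. -/
noncomputable def bilinear (n : ℤ) (ρ : ℂ[X]) : ℂ[X] :=
  (X + C (n : ℂ)) * ρ ^ 2 - 2 * X * ρ * derivative (derivative ρ)
    + 2 * X * (derivative ρ) ^ 2 - 2 * ρ * derivative ρ

/-- The factor of `ρ_{n+1} ρ_{n-1}` in the Ohyama recursion: `1` for odd `n`, `s` for even `n`. -/
noncomputable def parityFactor (n : ℤ) : ℂ[X] := if Even n then X else 1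

/-- A two-sided sequence of polynomials with the initial values and satisfying the recursion that
define the Ohyama polynomials. -/
structure IsOhyamaSequence (ρ : ℤ → ℂ[X]) : Prop where
  zero : ρ 0 = 1
  one : ρ 1 = 1
  neg_one : ρ (-1) = 1
  recursion : ∀ n : ℤ, bilinear n (ρ n) = parityFactor n * (ρ (n + 1) * ρ (n - 1))

/-- One half of the sequence of Ohyama polynomials: `half δ m = ρ_{δ m}` for `δ = ±1`, obtained by
solving the recursion (taken at the index `δ (m + 1)`) for the outermost member. -/
noncomputable def half (δ : ℤ) : ℕ → ℂ[X]
  | 0 => 1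
  | 1 => 1
  | m + 2 => bilinear (δ * (m + 1)) (half δ (m + 1)) / (parityFactor (δ * (m + 1)) * half δ m)

/-- The Ohyama polynomials `ρ_n`, `n ∈ ℤ`. -/
noncomputable def ohyama (n : ℤ) : ℂ[X] := half n.sign n.natAbs

/-- The conditions that specify the coefficients `A_{m,k}`. -/
structure IsEntryCoeff (A : ℤ → ℤ → ℝ) : Prop where
  support : ∀ m k : ℤ, A m k ≠ 0 → 0 ≤ m ∧ 0 ≤ k
  recursion : ∀ m k : ℤ, k ≠ 0 →
    ((k : ℝ) + 1) / 3 * A m (k + 1) - A m k + 3 * √3 / (k : ℝ) * A (m - 1) (k - 2) = 0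
  diagonal : ∀ m : ℕ, A m (2 * m) =
    (3 * √3 / 2) ^ m * ((3 : ℝ) ^ (1 / 4 : ℝ) / (m.factorial : ℝ))
  left : ∀ m : ℤ, 1 ≤ m → A m 0 = 0
  bottom : ∀ k : ℤ, 1 ≤ k → A 0 k = 0

/-- The coefficients `A_{m,k}` for `m, k ≥ 0`: row `m` vanishes beyond `k = 2m`, has the prescribed
values at `k = 2m` and at `k = 0` (for `m ≥ 1`), and is filled in by the recursion, from
`k = 2m - 1` downwards to `k = 1`. -/
noncomputable def coeffNat : ℕ → ℕ → ℝ
  | 0, k => if k = 0 then (3 : ℝ) ^ (1 / 4 : ℝ) else 0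
  | m + 1, k =>
    if k = 0 ∨ 2 * (m + 1) < k then 0
    else if k = 2 * (m + 1) then
      (3 * √3 / 2) ^ (m + 1) * ((3 : ℝ) ^ (1 / 4 : ℝ) / ((m + 1).factorial : ℝ))
    else
      ((k : ℝ) + 1) / 3 * coeffNat (m + 1) (k + 1)
        + 3 * √3 / (k : ℝ) * (if k < 2 then 0 else coeffNat m (k - 2))
  termination_by m k => (m, 2 * m + 1 - k)
  decreasing_by
  · apply Prod.Lex.right
    omega
  · apply Prod.Lex.left
    omega

/-- The coefficients `A_{m,k}` for integers `m, k`, zero if an index is negative. -/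
noncomputable def coeff (m k : ℤ) : ℝ :=
  if 0 ≤ m ∧ 0 ≤ k then coeffNat m.toNat k.toNat else 0

/-- `s = 3 (z/2)^{2/3}`, with the principal branch of the power. -/
noncomputable def sVar (z : ℂ) : ℂ := 3 * (z / 2) ^ (2 / 3 : ℂ)

/-- The Wronskian entry `W_n`, `n ≠ 0`, as a function of `z`:
`∑_{k=0}^{2|n|-2} A_{|n|-1,k} (δ s / 3)^k` with `δ = sgn n`. -/
noncomputable def entry (n : ℤ) (z : ℂ) : ℂ :=
  ∑ k ∈ Finset.range (2 * n.natAbs - 1),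
    (coeff (|n| - 1) k : ℂ) * ((n.sign : ℂ) * sVar z / 3) ^ k

/-- The Wronskian determinant of `N` functions of a complex variable (equal to `1` for `N = 0`). -/
noncomputable def wronskian {N : ℕ} (f : Fin N → ℂ → ℂ) (z : ℂ) : ℂ :=
  (Matrix.of fun i j : Fin N => iteratedDeriv i (f j) z).det

/-- `Wr(W_δ, W_{2δ}, …, W_n)` with `δ = sgn n`, the derivatives being taken in `z`. -/
noncomputable def entryWronskian (n : ℤ) (z : ℂ) : ℂ :=
  wronskian (fun j : Fin n.natAbs => entry (n.sign * ((j : ℤ) + 1))) z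

end Ohyama

/-!
Up to constant factors the entries `W_{j+1}` are polynomials `p_j` in `s` with `p_0 = 1`, and the
recursion for the `A_{m,k}` says `p_{j+1}'' - p_{j+1}' = -s p_j`. Let `T_n` be the Wronskian of
`p_0, …, p_{n-1}` with respect to `s`. Successive Darboux transformations by `p_0, p_1, …` preserve
the shape of this relation, and this gives first a relation expressing `T_{n+1}²` through `T_n` and
`T_{n+2}` and then, by induction on `n`, the bilinear relation
`(s + n + 1) T² - 2 s T T'' + 2 s T'² - 2 T T' = T_n T_{n+2}` for `T = T_{n+1}`. A third relation,
between `T_n T_{n+3}` and `T_{n+1} T_{n+2}`, shows that `T_n` vanishes at `0` exactly to the order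
`∑_{j<n} ⌊j/2⌋`. Dividing `T_n` by this power of `s` turns the bilinear relation into the Ohyama
recursion, so the quotient is `ρ_n` for `n ≥ 0`; the negative indices follow from the symmetry
`ρ_{-n}(s) = ± ρ_n(-s)`. Finally `s = 3 t²` and `ds/dz = 1/t` for `t = (z/2)^{1/3}`, so the
Wronskian with respect to `z` differs from `T_n` by a power of `t` only.
-/

namespace Ohyama

section DifferentialOperators

variable {R : Type*} [CommRing R] {N : ℕ} {c d : R[X]} {L M : R[X] → R[X]}

/-- `L` is a linear differential operator `∑_{k ≤ N} a_k ∂^k` with polynomial coefficients and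
`a_N = c`. As `c = 0` is allowed, `N` is only a bound on the order. -/
def IsDiffOp (N : ℕ) (c : R[X]) (L : R[X] → R[X]) : Prop :=
  ∃ a : ℕ → R[X], a N = c ∧ ∀ f, L f = ∑ k ∈ Finset.range (N + 1), a k * derivative^[k] f

lemma IsDiffOp.add (hL : IsDiffOp N c L) (hM : IsDiffOp N d M) :
    IsDiffOp N (c + d) fun f => L f + M f := by
  obtain ⟨a, rfl, hL⟩ := hL
  obtain ⟨b, rfl, hM⟩ := hM
  exact ⟨fun k => a k + b k, rfl, fun f => by
    simp only [hL, hM, add_mul, Finset.sum_add_distrib]⟩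

lemma IsDiffOp.mul_left (g : R[X]) (hL : IsDiffOp N c L) :
    IsDiffOp N (g * c) fun f => g * L f := by
  obtain ⟨a, rfl, hL⟩ := hL
  exact ⟨fun k => g * a k, rfl, fun f => by simp only [hL, Finset.mul_sum, mul_assoc]⟩

lemma IsDiffOp.succ (hL : IsDiffOp N c L) : IsDiffOp (N + 1) 0 L := by
  obtain ⟨a, -, hL⟩ := hL
  refine ⟨Function.update a (N + 1) 0, Function.update_self .., fun f => ?_⟩
  rw [Finset.sum_range_succ, Function.update_self, zero_mul, add_zero, hL]
  refine Finset.sum_congr rfl fun k hk => ?_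
  rw [Function.update_of_ne (Finset.mem_range.1 hk).ne]

lemma IsDiffOp.derivative_comp (hL : IsDiffOp N c L) :
    IsDiffOp (N + 1) c fun f => derivative (L f) := by
  obtain ⟨a, rfl, hL⟩ := hL
  have hcoeff : IsDiffOp (N + 1) 0 fun f =>
      ∑ k ∈ Finset.range (N + 1), derivative (a k) * derivative^[k] f :=
    IsDiffOp.succ ⟨fun k => derivative (a k), rfl, fun _ => rfl⟩
  have hshift : IsDiffOp (N + 1) (a N) fun f =>
      ∑ k ∈ Finset.range (N + 1), a k * derivative^[k + 1] f :=
    ⟨fun k => if k = 0 then 0 else a (k - 1), by simp, fun f => by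
      simp [Finset.sum_range_succ' _ (N + 1)]⟩
  have hsum := hcoeff.add hshift
  rw [zero_add] at hsum
  convert hsum using 2 with f
  rw [hL, derivative_sum, ← Finset.sum_add_distrib]
  exact Finset.sum_congr rfl fun k _ => by rw [derivative_mul, Function.iterate_succ_apply']

end DifferentialOperators

section PolynomialWronskian

variable {R : Type*} [CommRing R] {p : ℕ → R[X]} {N : ℕ}

/-- The Wronskian determinant of the polynomials `p 0, …, p (N - 1)`. -/
noncomputable def polyWronskian (p : ℕ → R[X]) (N : ℕ) : R[X] :=
  (Matrix.of fun i j : Fin N => derivative^[i] (p j)).det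

/-- The Wronskian determinant of `p 0, …, p (N - 1), f`. -/
noncomputable def borderedWronskian (p : ℕ → R[X]) (N : ℕ) (f : R[X]) : R[X] :=
  polyWronskian (Function.update p N f) (N + 1)

lemma polyWronskian_zero (p : ℕ → R[X]) : polyWronskian p 0 = 1 := Matrix.det_fin_zero

lemma polyWronskian_one (p : ℕ → R[X]) : polyWronskian p 1 = p 0 := Matrix.det_fin_one _

lemma polyWronskian_C_mul (a : ℕ → R) (p : ℕ → R[X]) (N : ℕ) :
    polyWronskian (fun j => C (a j) * p j) N =
      C (∏ j ∈ Finset.range N, a j) * polyWronskian p N := by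
  have h := Matrix.det_mul_row (fun j : Fin N => C (a j))
    (Matrix.of fun i j : Fin N => derivative^[i] (p j))
  rw [map_prod, Finset.prod_range, polyWronskian, polyWronskian, ← h]
  simp only [iterate_derivative_C_mul, Matrix.of_apply]

lemma borderedWronskian_zero (p : ℕ → R[X]) (f : R[X]) : borderedWronskian p 0 f = f := by
  rw [borderedWronskian, polyWronskian_one, Function.update_self]

lemma borderedWronskian_self (p : ℕ → R[X]) (N : ℕ) :
    borderedWronskian p N (p N) = polyWronskian p (N + 1) := by
  rw [borderedWronskian, Function.update_eq_self]

lemma borderedWronskian_eq_zero (p : ℕ → R[X]) {N j : ℕ} (hj : j < N) :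
    borderedWronskian p N (p j) = 0 := by
  refine Matrix.det_zero_of_column_eq (i := Fin.castSucc ⟨j, hj⟩) (j := Fin.last N)
    (Fin.castSucc_lt_last _).ne fun i => ?_
  simp [Function.update_of_ne hj.ne]

lemma isDiffOp_borderedWronskian (p : ℕ → R[X]) (N : ℕ) :
    IsDiffOp N (polyWronskian p N) (borderedWronskian p N) := by
  let minor (k : Fin (N + 1)) : R[X] :=
    (Matrix.of fun i j : Fin N => derivative^[k.succAbove i] (p j)).det
  refine ⟨fun k => (-1) ^ (k + N) * minor (Fin.ofNat (N + 1) k), ?_, fun f => ?_⟩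
  · simp [minor, polyWronskian, ← two_mul]
  rw [borderedWronskian, polyWronskian, Matrix.det_succ_column _ (Fin.last N), Finset.sum_range]
  refine Finset.sum_congr rfl fun k _ => ?_
  have hminor : (Matrix.of fun i j : Fin (N + 1) =>
      derivative^[i] (Function.update p N f j)).submatrix k.succAbove (Fin.last N).succAbove =
      Matrix.of fun i j : Fin N => derivative^[k.succAbove i] (p j) := by
    ext i j : 2
    simp [Function.update_of_ne j.2.ne]
  simp only [hminor, Matrix.of_apply, Fin.val_last, Function.update_self, minor,
    Fin.ofNat_val_eq_self]
  exact mul_right_comm _ _ _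

lemma IsDiffOp.eq_zero [IsDomain R] {L : R[X] → R[X]} (hL : IsDiffOp N 0 L)
    (hp : polyWronskian p N ≠ 0) (h : ∀ j < N, L (p j) = 0) (f : R[X]) : L f = 0 := by
  obtain ⟨a, ha, hL⟩ := hL
  simp only [Finset.sum_range_succ, ha, zero_mul, add_zero] at hL
  have hcoeff : (fun k : Fin N => a k) = 0 :=
    Matrix.eq_zero_of_vecMul_eq_zero hp <| funext fun j => by
      rw [Pi.zero_apply, ← h j j.2, hL, Finset.sum_range]
      rfl
  rw [hL, Finset.sum_range]
  exact Finset.sum_eq_zero fun k _ => by rw [congrFun hcoeff k, Pi.zero_apply, zero_mul]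

lemma polyWronskian_mul_borderedWronskian [IsDomain R] (hp : polyWronskian p (N + 1) ≠ 0)
    (f : R[X]) : polyWronskian p N * borderedWronskian p (N + 1) f =
      Polynomial.wronskian (polyWronskian p (N + 1)) (borderedWronskian p N f) := by
  -- Both sides are operators of order `N + 1` in `f` with the same top coefficient, and both
  -- annihilate `p 0, …, p N`.
  have hdiff := ((isDiffOp_borderedWronskian p (N + 1)).mul_left (polyWronskian p N)).add
    (((isDiffOp_borderedWronskian p N).derivative_comp.mul_left (-polyWronskian p (N + 1))).add
      ((isDiffOp_borderedWronskian p N).succ.mul_left (derivative (polyWronskian p (N + 1)))))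
  rw [show polyWronskian p N * polyWronskian p (N + 1) + (-polyWronskian p (N + 1) *
    polyWronskian p N + derivative (polyWronskian p (N + 1)) * 0) = 0 by ring] at hdiff
  have hzero := hdiff.eq_zero hp (fun j hj => ?_) f
  · rw [Polynomial.wronskian]
    linear_combination hzero
  rw [borderedWronskian_eq_zero p hj]
  rcases Nat.lt_succ_iff_lt_or_eq.1 hj with h | rfl
  · rw [borderedWronskian_eq_zero p h, derivative_zero]
    ring
  · rw [borderedWronskian_self]
    ring

end PolynomialWronskian

section GaugeWronskian

variable {R : Type*} [CommRing R] {ν : R} {f g A B D u w x y : R[X]}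

/-- The Wronskian of `f` and `X^(-ν) e^(-X) g`, multiplied by `X^(1 + ν) e^X`. -/
noncomputable def gaugeWronskian (ν : R) (f g : R[X]) : R[X] :=
  X * Polynomial.wronskian f g - (X + C ν) * (f * g)

lemma gaugeWronskian_sub_right (ν : R) (f g h : R[X]) :
    gaugeWronskian ν f (g - h) = gaugeWronskian ν f g - gaugeWronskian ν f h := by
  simp only [gaugeWronskian, Polynomial.wronskian, derivative_sub]
  ring

lemma gaugeWronskian_mul_mul (ν : R) (h f g : R[X]) :
    gaugeWronskian ν (h * f) (h * g) = h ^ 2 * gaugeWronskian ν f g := by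
  simp only [gaugeWronskian, Polynomial.wronskian, derivative_mul]
  ring

variable [IsDomain R]

lemma eq_zero_of_gaugeWronskian_eq_zero (hf : f ≠ 0) (h : gaugeWronskian ν f g = 0) : g = 0 := by
  by_contra hg
  have hlt : (X * Polynomial.wronskian f g).degree < ((X + C ν) * (f * g)).degree := by
    rw [degree_mul, degree_mul, degree_X, degree_X_add_C, degree_mul]
    exact WithBot.add_lt_add_left WithBot.one_ne_bot (degree_wronskian_lt_add hf hg)
  exact hlt.ne (congrArg degree (sub_eq_zero.1 h))

lemma gaugeWronskian_darboux_succ (hA : A ≠ 0) (hB : B ≠ 0)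
    (hu : gaugeWronskian ν A u = -X ^ 2 * (B * w)) (hD : gaugeWronskian ν A D = -X ^ 2 * (B * B))
    (hx : B * x = Polynomial.wronskian D u) (hy : A * y = Polynomial.wronskian B w) :
    gaugeWronskian (ν + 1) B x = -X ^ 2 * (D * y) := by
  simp only [gaugeWronskian, Polynomial.wronskian] at hu hD hx hy ⊢
  have hAx : A * x = X * (u * B - D * w) := by
    refine mul_left_cancel₀ (mul_ne_zero X_ne_zero hB) ?_
    linear_combination D * hu - u * hD + X * A * hx
  have hAx' := congrArg derivative hAx
  simp only [derivative_mul, derivative_sub, derivative_X] at hAx'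
  refine mul_left_cancel₀ (pow_ne_zero 2 hA) ?_
  simp only [map_add, map_one]
  linear_combination X * B * A * hAx'
    - (X * B * derivative A + X * A * derivative B + (X + C ν + 1) * A * B) * hAx
    + X * B * B * hu - X * B * w * hD + X ^ 2 * D * A * hy

end GaugeWronskian

section BilinearForms

variable {R : Type*} [CommRing R] {ν : R} {A B D E Z : R[X]}

/-- The numerator, over `X² B D`, of the left-hand side of the Riccati equation
`v' + v² - (1 + ν/X) v + 2 (log B)'' - (log B)'/X + ν/X + ν(ν - 1)/X² = 0`
for `v = (log (D/B))'`. -/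
noncomputable def riccatiForm (ν : R) (B D : R[X]) : R[X] :=
  X ^ 2 * (derivative (derivative D) * B - 2 * derivative D * derivative B
      + D * derivative (derivative B))
    - X * (X + C ν) * Polynomial.wronskian B D - X * derivative B * D
    + C ν * X * B * D + C (ν * (ν - 1)) * B * D

/-- The bilinear expression `Ohyama.bilinear` with an arbitrary parameter `ν` in place of an integer
and over an arbitrary ring. -/
noncomputable def todaForm (ν : R) (f : R[X]) : R[X] :=
  (X + C ν) * f ^ 2 - 2 * X * f * derivative (derivative f)
    + 2 * X * (derivative f) ^ 2 - 2 * f * derivative f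

lemma todaForm_C_mul (ν c : R) (f : R[X]) : todaForm ν (C c * f) = C c ^ 2 * todaForm ν f := by
  simp only [todaForm, derivative_C_mul]
  ring

lemma todaForm_comp_C_mul_X {a : R} (ha : a * a = 1) (ν : R) (f : R[X]) :
    todaForm (a * ν) (f.comp (C a * X)) = C a * (todaForm ν f).comp (C a * X) := by
  have hCa : C a * C a = 1 := by rw [← C_mul, ha, C_1]
  simp only [todaForm, derivative_comp, derivative_mul, derivative_C, derivative_X, add_comp,
    sub_comp, mul_comp, pow_comp, X_comp, C_comp, ofNat_comp, map_mul, zero_mul, zero_add, mul_one]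
  linear_combination (-X * f.comp (C a * X) ^ 2) * hCa

lemma gaugeWronskian_todaForm (h : riccatiForm ν B D = 0) :
    gaugeWronskian ν (B ^ 2) (todaForm (ν + 1) D) =
      gaugeWronskian (ν - 1) (todaForm ν B) (D ^ 2) := by
  have h' := congrArg derivative h
  simp only [riccatiForm, todaForm, gaugeWronskian, Polynomial.wronskian, derivative_mul,
    derivative_X, derivative_C, derivative_pow, derivative_ofNat, derivative_zero, derivative_one,
    Nat.cast_ofNat, map_ofNat, map_add, map_one, map_mul, map_sub] at h h' ⊢
  linear_combination -2 * (h' * B * D - h * (derivative B * D + B * derivative D))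

variable [IsDomain R]

lemma riccatiForm_succ (hA : A ≠ 0) (hD : gaugeWronskian ν A D = -X ^ 2 * (B * B))
    (h : riccatiForm ν A B = 0) : riccatiForm (ν + 1) B D = 0 := by
  have hD' := congrArg derivative hD
  refine mul_left_cancel₀ hA ?_
  simp only [gaugeWronskian, riccatiForm, Polynomial.wronskian, derivative_mul, derivative_X,
    derivative_C, derivative_neg, derivative_X_pow, Nat.cast_ofNat, map_ofNat, map_add, map_one,
    map_mul, map_sub, mul_zero] at h hD hD' ⊢
  linear_combination D * h + X * B * hD' - (2 * X * derivative B + 2 * B) * hD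

lemma todaForm_succ (hB : B ≠ 0) (hBD : riccatiForm ν B D = 0)
    (hD : gaugeWronskian (ν - 1) A D = -X ^ 2 * (B * B))
    (hE : gaugeWronskian ν B E = -X ^ 2 * (D * D))
    (hA : todaForm ν B = A * D) : todaForm (ν + 1) D = B * E := by
  refine sub_eq_zero.1 (eq_zero_of_gaugeWronskian_eq_zero (ν := ν) (pow_ne_zero 2 hB) ?_)
  rw [gaugeWronskian_sub_right, gaugeWronskian_todaForm hBD, hA, sq D, mul_comm A,
    gaugeWronskian_mul_mul, hD, sq B, gaugeWronskian_mul_mul, hE]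
  ring

lemma mul_add_wronskian_succ (hA : A ≠ 0) (hB : B ≠ 0)
    (hD : gaugeWronskian (ν - 1) A D = -X ^ 2 * (B * B))
    (hE : todaForm (ν + 1) D = B * E) (hZ : todaForm (ν - 1) A = Z * B)
    (h : Z * D + 2 * X ^ 2 * Polynomial.wronskian A B = X * (X + C (4 * ν - 3)) * (A * B)) :
    A * E + 2 * X ^ 2 * Polynomial.wronskian B D = X * (X + C (4 * ν + 1)) * (B * D) := by
  have hD' := congrArg derivative hD
  refine mul_left_cancel₀ (mul_ne_zero hB hA) ?_
  simp only [gaugeWronskian, Polynomial.wronskian, todaForm, derivative_mul, derivative_X,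
    derivative_C, derivative_neg, derivative_X_pow, Nat.cast_ofNat, map_ofNat, map_add, map_one,
    map_mul, map_sub, derivative_one] at hD hD' h hE hZ ⊢
  linear_combination -A ^ 2 * hE + D ^ 2 * hZ + B * D * h - 2 * A * D * hD'
    + 2 * (derivative A * D + A * derivative D) * hD

end BilinearForms

section Chain

variable {R : Type*} [CommRing R]

/-- A sequence of polynomials starting with `p 0 = 1` in which the operator `-X⁻¹ (∂² - ∂)` lowers
the index by one; the Darboux transformations act on such sequences. -/
structure IsChain (p : ℕ → R[X]) : Prop where
  zero : p 0 = 1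
  succ : ∀ m, derivative (derivative (p (m + 1))) - derivative (p (m + 1)) = -X * p m

/-- The `n`-fold Darboux transform `borderedWronskian p n (p j) / polyWronskian p n` of the sequence
`p` again has a second-order lowering operator. It factors through the `(n + 1)`-fold transform;
this relation is its second factor, cleared of denominators. -/
def Intertwines (p : ℕ → R[X]) (n : ℕ) : Prop :=
  ∀ j, gaugeWronskian (n : R) (polyWronskian p n) (borderedWronskian p (n + 1) (p (j + 1))) =
    -X ^ 2 * (polyWronskian p (n + 1) * borderedWronskian p n (p j))

variable {p : ℕ → R[X]}

lemma Intertwines.diagonal {n : ℕ} (h : Intertwines p n) :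
    gaugeWronskian (n : R) (polyWronskian p n) (polyWronskian p (n + 2)) =
      -X ^ 2 * (polyWronskian p (n + 1) * polyWronskian p (n + 1)) := by
  simpa only [borderedWronskian_self] using h n

lemma IsChain.polyWronskian_one (h : IsChain p) : polyWronskian p 1 = 1 := by
  rw [Ohyama.polyWronskian_one, h.zero]

lemma IsChain.derivative_one (h : IsChain p) : derivative (p 1) = X + 1 := by
  have hp := h.succ 0
  rw [h.zero] at hp
  have hfix : derivative (derivative (p 1) - (X + 1)) = derivative (p 1) - (X + 1) := by
    simp only [derivative_sub, derivative_add, derivative_X, Polynomial.derivative_one]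
    linear_combination hp
  by_contra hne
  have hlt := degree_derivative_lt (sub_ne_zero.2 hne)
  exact hlt.ne (congrArg degree hfix)

variable [IsDomain R]

lemma Intertwines.polyWronskian_ne_zero {n : ℕ} (h : Intertwines p n)
    (h1 : polyWronskian p (n + 1) ≠ 0) : polyWronskian p (n + 2) ≠ 0 := by
  intro h2
  have hsq := h.diagonal
  rw [h2, gaugeWronskian, wronskian_zero_right, mul_zero, mul_zero, mul_zero, sub_zero] at hsq
  exact mul_ne_zero (neg_ne_zero.2 (pow_ne_zero 2 X_ne_zero)) (mul_ne_zero h1 h1) hsq.symm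

lemma Intertwines.succ {n : ℕ} (h : Intertwines p n) (h0 : polyWronskian p n ≠ 0)
    (h1 : polyWronskian p (n + 1) ≠ 0) : Intertwines p (n + 1) := by
  intro j
  rw [Nat.cast_succ]
  exact gaugeWronskian_darboux_succ h0 h1 (h j) h.diagonal
    (polyWronskian_mul_borderedWronskian (h.polyWronskian_ne_zero h1) (p (j + 1)))
    (polyWronskian_mul_borderedWronskian h1 (p j))

namespace IsChain

variable (h : IsChain p)

include h

lemma borderedWronskian_one (f : R[X]) : borderedWronskian p 1 f = derivative f := by
  have hJacobi := polyWronskian_mul_borderedWronskian (p := p) (N := 0)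
    (h.polyWronskian_one ▸ one_ne_zero) f
  simpa [h.polyWronskian_one, polyWronskian_zero, borderedWronskian_zero, Polynomial.wronskian]
    using hJacobi

lemma polyWronskian_two : polyWronskian p 2 = X + 1 := by
  rw [← borderedWronskian_self, h.borderedWronskian_one, h.derivative_one]

lemma intertwines_zero : Intertwines p 0 := by
  intro j
  simp only [zero_add, h.borderedWronskian_one, borderedWronskian_zero, polyWronskian_zero,
    h.polyWronskian_one, Nat.cast_zero, C_0, gaugeWronskian, Polynomial.wronskian,
    Polynomial.derivative_one]
  linear_combination X * h.succ j

lemma polyWronskian_ne_zero_and_intertwines (n : ℕ) :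
    polyWronskian p n ≠ 0 ∧ polyWronskian p (n + 1) ≠ 0 ∧ Intertwines p n := by
  induction n with
  | zero => exact ⟨polyWronskian_zero p ▸ one_ne_zero, h.polyWronskian_one ▸ one_ne_zero,
      h.intertwines_zero⟩
  | succ n ih =>
    obtain ⟨h0, h1, hn⟩ := ih
    exact ⟨h1, hn.polyWronskian_ne_zero h1, hn.succ h0 h1⟩

lemma polyWronskian_ne_zero (n : ℕ) : polyWronskian p n ≠ 0 :=
  (h.polyWronskian_ne_zero_and_intertwines n).1

lemma gaugeWronskian_polyWronskian (n : ℕ) :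
    gaugeWronskian (n : R) (polyWronskian p n) (polyWronskian p (n + 2)) =
      -X ^ 2 * (polyWronskian p (n + 1) * polyWronskian p (n + 1)) :=
  (h.polyWronskian_ne_zero_and_intertwines n).2.2.diagonal

lemma riccatiForm_polyWronskian (n : ℕ) :
    riccatiForm (n : R) (polyWronskian p n) (polyWronskian p (n + 1)) = 0 := by
  induction n with
  | zero => simp [riccatiForm, Polynomial.wronskian, polyWronskian_zero, h.polyWronskian_one]
  | succ n ih =>
    rw [Nat.cast_succ]
    exact riccatiForm_succ (h.polyWronskian_ne_zero n) (h.gaugeWronskian_polyWronskian n) ih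

lemma todaForm_polyWronskian (n : ℕ) :
    todaForm (n + 1 : R) (polyWronskian p (n + 1)) =
      polyWronskian p n * polyWronskian p (n + 2) := by
  induction n with
  | zero => simp [todaForm, polyWronskian_zero, h.polyWronskian_one, h.polyWronskian_two]
  | succ n ih =>
    rw [Nat.cast_succ]
    refine todaForm_succ (h.polyWronskian_ne_zero (n + 1)) ?_ ?_ ?_ ih
    · exact_mod_cast h.riccatiForm_polyWronskian (n + 1)
    · simpa only [add_sub_cancel_right] using h.gaugeWronskian_polyWronskian n
    · exact_mod_cast h.gaugeWronskian_polyWronskian (n + 1)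

lemma polyWronskian_mul_add_wronskian (n : ℕ) :
    polyWronskian p n * polyWronskian p (n + 3)
      + 2 * X ^ 2 * Polynomial.wronskian (polyWronskian p (n + 1)) (polyWronskian p (n + 2)) =
    X * (X + C (4 * n + 5 : R)) * (polyWronskian p (n + 1) * polyWronskian p (n + 2)) := by
  induction n with
  | zero =>
    have h3 := h.todaForm_polyWronskian 1
    simp only [Nat.reduceAdd, Nat.cast_zero, Nat.cast_one, zero_add, todaForm,
      h.polyWronskian_one, h.polyWronskian_two, polyWronskian_zero, Polynomial.wronskian,
      derivative_X, Polynomial.derivative_one, map_add, map_one, map_mul, map_ofNat,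
      map_zero] at h3 ⊢
    linear_combination -h3
  | succ n ih =>
    have hD := h.gaugeWronskian_polyWronskian (n + 1)
    have hE := h.todaForm_polyWronskian (n + 2)
    have hZ := h.todaForm_polyWronskian n
    push_cast at hD hE ⊢
    rw [show (n + 1 : R) = n + 2 - 1 by ring] at hD hZ
    rw [show (4 * n + 5 : R) = 4 * (n + 2) - 3 by ring] at ih
    rw [show (4 * (n + 1) + 5 : R) = 4 * (n + 2) + 1 by ring]
    exact mul_add_wronskian_succ (h.polyWronskian_ne_zero (n + 1))
      (h.polyWronskian_ne_zero (n + 2)) hD hE hZ ih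

end IsChain

end Chain

section VanishingOrder

/-- The order of vanishing at `0` of the Wronskian of the first `n` members of a chain. -/
def wronskianOrder (n : ℕ) : ℕ := ∑ j ∈ Finset.range n, j / 2

lemma wronskianOrder_succ (n : ℕ) : wronskianOrder (n + 1) = wronskianOrder n + n / 2 :=
  Finset.sum_range_succ ..

/-- What remains of `polyWronskian p n` after division by its power of `X`; the division is exact
if `p` is a chain. -/
noncomputable def reducedWronskian {R : Type*} [CommRing R] (p : ℕ → R[X]) (n : ℕ) : R[X] :=
  polyWronskian p n /ₘ X ^ wronskianOrder n

section CommRing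

variable {R : Type*} [CommRing R]

lemma X_mul_derivative_X_pow_mul (a : ℕ) (f : R[X]) :
    X * derivative (X ^ a * f) = X ^ a * (C (a : R) * f + X * derivative f) := by
  rw [derivative_mul]
  rcases a with _ | a
  · simp
  · rw [derivative_X_pow, Nat.add_sub_cancel]
    ring

lemma X_mul_wronskian_X_pow_mul (a b : ℕ) (f g : R[X]) :
    X * Polynomial.wronskian (X ^ a * f) (X ^ b * g) =
      X ^ (a + b) * (C (b - a : R) * (f * g) + X * Polynomial.wronskian f g) := by
  have hf := X_mul_derivative_X_pow_mul a f
  have hg := X_mul_derivative_X_pow_mul b g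
  rw [Polynomial.wronskian, Polynomial.wronskian, C_sub]
  linear_combination X ^ a * f * hg - X ^ b * g * hf

lemma X_mul_todaForm (ν : R) (f : R[X]) :
    X * todaForm ν f = X * (X + C ν) * f ^ 2 - 2 * f * (X * derivative (X * derivative f))
      + 2 * (X * derivative f) ^ 2 := by
  simp only [todaForm, derivative_mul, derivative_X]
  ring

lemma todaForm_X_pow_mul (ν : R) (a : ℕ) (f : R[X]) :
    todaForm ν (X ^ a * f) = X ^ (2 * a) * todaForm ν f := by
  refine isRegular_X.left ?_
  change X * _ = X * _
  rw [mul_left_comm, X_mul_todaForm, X_mul_todaForm, X_mul_derivative_X_pow_mul,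
    X_mul_derivative_X_pow_mul]
  simp only [derivative_add, derivative_mul, derivative_C, derivative_X]
  ring

/-- For `δ = ±1`, the half `ρ_0, ρ_δ, ρ_{2δ}, …` of a solution of the Ohyama recursion. -/
structure IsHalfSequence (δ : R) (σ : ℕ → R[X]) : Prop where
  zero : σ 0 = 1
  one : σ 1 = 1
  recursion : ∀ m : ℕ,
    todaForm (δ * (m + 1)) (σ (m + 1)) = X ^ (m % 2) * (σ m * σ (m + 2))

end CommRing

variable {R : Type*} [CommRing R] [IsDomain R] {p : ℕ → R[X]}

lemma exists_eq_X_pow_mul_of_mul_eq {W f H : R[X]} {e : ℕ} (hf : f.coeff 0 ≠ 0)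
    (hH : H.coeff 0 ≠ 0) (h : W * f = X ^ e * H) : ∃ q : R[X], q.coeff 0 ≠ 0 ∧ W = X ^ e * q := by
  obtain ⟨q, rfl⟩ := prime_X.pow_dvd_of_dvd_mul_right _ (mt X_dvd_iff.1 hf) (Dvd.intro _ h.symm)
  rw [mul_assoc] at h
  refine ⟨q, fun hq => hH ?_, rfl⟩
  rw [← mul_left_cancel₀ (pow_ne_zero e X_ne_zero) h, mul_coeff_zero, hq, zero_mul]

lemma IsChain.polyWronskian_mul_eq_X_pow_mul (h : IsChain p) {n : ℕ} {f g k : R[X]}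
    (hf : polyWronskian p n = X ^ wronskianOrder n * f)
    (hg : polyWronskian p (n + 1) = X ^ wronskianOrder (n + 1) * g)
    (hk : polyWronskian p (n + 2) = X ^ wronskianOrder (n + 2) * k) :
    polyWronskian p (n + 3) * f = X ^ wronskianOrder (n + 3) *
      ((X + C (4 * n + 5 - 2 * ((n + 1) / 2 : ℕ) : R)) * (g * k)
        - 2 * X * Polynomial.wronskian g k) := by
  have horder : wronskianOrder n + wronskianOrder (n + 3) =
      wronskianOrder (n + 1) + wronskianOrder (n + 2) + 1 := by
    simp only [wronskianOrder_succ]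
    omega
  have hwr := X_mul_wronskian_X_pow_mul (wronskianOrder (n + 1)) (wronskianOrder (n + 2)) g k
  have hrel := h.polyWronskian_mul_add_wronskian n
  rw [← hg, ← hk, wronskianOrder_succ (n + 1), Nat.cast_add, add_sub_cancel_left,
    ← wronskianOrder_succ] at hwr
  refine mul_left_cancel₀ (pow_ne_zero (wronskianOrder n) X_ne_zero) ?_
  rw [← mul_assoc (X ^ _) (X ^ _), ← pow_add, horder]
  simp only [map_sub, map_mul, map_ofNat]
  rw [hf, hg, hk] at hrel
  rw [hg, hk] at hwr
  linear_combination hrel - 2 * X * hwr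

variable [CharZero R]

lemma IsChain.exists_polyWronskian_eq (h : IsChain p) : ∀ n : ℕ, ∃ q : R[X], q.coeff 0 ≠ 0 ∧
    polyWronskian p n = X ^ wronskianOrder n * q
  | 0 => ⟨1, by simp, by simp [polyWronskian_zero, wronskianOrder]⟩
  | 1 => ⟨1, by simp, by simp [h.polyWronskian_one, wronskianOrder]⟩
  | 2 => ⟨X + 1, by simp, by simp [h.polyWronskian_two, wronskianOrder, Finset.sum_range_succ]⟩
  | n + 3 => by
    obtain ⟨f, hf0, hf⟩ := h.exists_polyWronskian_eq n
    obtain ⟨g, hg0, hg⟩ := h.exists_polyWronskian_eq (n + 1)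
    obtain ⟨k, hk0, hk⟩ := h.exists_polyWronskian_eq (n + 2)
    refine exists_eq_X_pow_mul_of_mul_eq hf0 ?_ (h.polyWronskian_mul_eq_X_pow_mul hf hg hk)
    have hconst : (4 * n + 5 - 2 * ((n + 1) / 2 : ℕ) : R) ≠ 0 := by
      rw [show (4 * n + 5 - 2 * ((n + 1) / 2 : ℕ) : R) = (4 * n + 5 - 2 * ((n + 1) / 2) : ℕ) by
        rw [Nat.cast_sub (by omega)]; push_cast; rfl]
      exact Nat.cast_ne_zero.2 (by omega)
    simpa [mul_coeff_zero] using ⟨hconst, hg0, hk0⟩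

lemma IsChain.polyWronskian_eq (h : IsChain p) (n : ℕ) :
    polyWronskian p n = X ^ wronskianOrder n * reducedWronskian p n := by
  obtain ⟨q, -, hq⟩ := h.exists_polyWronskian_eq n
  rw [reducedWronskian, hq, mul_divByMonic_cancel_left q (monic_X_pow _)]

lemma IsChain.reducedWronskian_ne_zero (h : IsChain p) (m : ℕ) : reducedWronskian p m ≠ 0 :=
  right_ne_zero_of_mul (h.polyWronskian_eq m ▸ h.polyWronskian_ne_zero m)

lemma IsChain.isHalfSequence_reducedWronskian (h : IsChain p) :
    IsHalfSequence 1 (reducedWronskian p) where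
  zero := by simpa [polyWronskian_zero, wronskianOrder] using (h.polyWronskian_eq 0).symm
  one := by simpa [h.polyWronskian_one, wronskianOrder] using (h.polyWronskian_eq 1).symm
  recursion m := by
    have htoda := h.todaForm_polyWronskian m
    rw [h.polyWronskian_eq m, h.polyWronskian_eq (m + 1), h.polyWronskian_eq (m + 2),
      todaForm_X_pow_mul] at htoda
    have horder : wronskianOrder m + wronskianOrder (m + 2) =
        2 * wronskianOrder (m + 1) + m % 2 := by
      simp only [wronskianOrder_succ]
      omega
    refine mul_left_cancel₀ (pow_ne_zero (2 * wronskianOrder (m + 1)) X_ne_zero) ?_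
    rw [one_mul, htoda, mul_mul_mul_comm, ← pow_add, horder, pow_add, mul_assoc]

end VanishingOrder

section Sequence

variable {δ : ℤˣ} {σ : ℕ → ℂ[X]}

lemma units_cast_mul_self (δ : ℤˣ) : ((δ : ℤ) : ℂ) * (δ : ℤ) = 1 := by
  exact_mod_cast Int.units_coe_mul_self δ

lemma parityFactor_ne_zero (n : ℤ) : parityFactor n ≠ 0 := by
  unfold parityFactor
  split_ifs
  exacts [X_ne_zero, one_ne_zero]

lemma parityFactor_units_mul (δ : ℤˣ) (m : ℕ) : parityFactor (δ * (m + 1)) = X ^ (m % 2) := by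
  have hparity : Even ((δ : ℤ) * (m + 1)) ↔ ¬Even m := by
    rcases Int.units_eq_one_or δ with rfl | rfl <;> simp [parity_simps]
  rcases Nat.mod_two_eq_zero_or_one m with hm | hm <;>
    simp [parityFactor, hparity, Nat.even_iff, hm]

lemma bilinear_units_mul (δ : ℤˣ) (m : ℕ) (f : ℂ[X]) :
    bilinear (δ * (m + 1)) f = todaForm ((δ : ℤ) * (m + 1) : ℂ) f := by
  simp only [bilinear, todaForm, Int.cast_mul, Int.cast_add, Int.cast_natCast, Int.cast_one]

lemma IsHalfSequence.half_eq (hσ : IsHalfSequence ((δ : ℤ) : ℂ) σ)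
    (hne : ∀ m, half δ m = σ m → σ m ≠ 0) : ∀ m, half δ m = σ m
  | 0 => hσ.zero.symm
  | 1 => hσ.one.symm
  | m + 2 => by
    have h0 := hσ.half_eq hne m
    have hdiv : parityFactor (δ * (m + 1)) * σ m ≠ 0 :=
      mul_ne_zero (parityFactor_ne_zero _) (hne m h0)
    rw [half, h0, hσ.half_eq hne (m + 1), bilinear_units_mul, hσ.recursion,
      ← parityFactor_units_mul δ, ← mul_assoc, mul_div_cancel_left₀ _ hdiv]

lemma natAbs_units_mul (δ : ℤˣ) (m : ℕ) : ((δ : ℤ) * m).natAbs = m := by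
  rw [Int.natAbs_mul, Int.units_natAbs, one_mul, Int.natAbs_natCast]

lemma sign_units_mul {m : ℕ} (hm : m ≠ 0) : ((δ : ℤ) * m).sign = δ := by
  rw [Int.sign_mul, Int.sign_natCast_of_ne_zero hm, mul_one]
  rcases Int.units_eq_one_or δ with rfl | rfl <;> rfl

lemma ohyama_units_mul (δ : ℤˣ) (m : ℕ) : ohyama (δ * m) = half δ m := by
  rcases m with _ | m
  · simp [ohyama, half]
  · rw [ohyama, sign_units_mul m.succ_ne_zero, natAbs_units_mul]

lemma exists_eq_units_mul_natCast (n : ℤ) : ∃ (δ : ℤˣ) (m : ℕ), n = δ * m := by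
  obtain ⟨m, rfl | rfl⟩ := n.eq_nat_or_neg
  · exact ⟨1, m, by simp⟩
  · exact ⟨-1, m, by simp⟩

lemma mul_units_mul_neighbours (ρ : ℤ → ℂ[X]) (δ : ℤˣ) (m : ℕ) :
    ρ (δ * (m + 1) + 1) * ρ (δ * (m + 1) - 1) = ρ (δ * m) * ρ (δ * (m + 2)) := by
  rcases Int.units_eq_one_or δ with rfl | rfl
  · rw [mul_comm]
    congr 2
    push_cast
    ring
  · congr 2
    push_cast
    ring

lemma isOhyamaSequence_iff {ρ : ℤ → ℂ[X]} :
    IsOhyamaSequence ρ ↔ ∀ δ : ℤˣ, IsHalfSequence ((δ : ℤ) : ℂ) fun m => ρ (δ * m) := by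
  have hrec (δ : ℤˣ) (m : ℕ) : bilinear (δ * (m + 1)) (ρ (δ * (m + 1))) =
      parityFactor (δ * (m + 1)) * (ρ (δ * (m + 1) + 1) * ρ (δ * (m + 1) - 1)) ↔
      todaForm ((δ : ℤ) * (m + 1) : ℂ) (ρ (δ * (m + 1))) =
      X ^ (m % 2) * (ρ (δ * m) * ρ (δ * (m + 2))) := by
    rw [bilinear_units_mul, parityFactor_units_mul, mul_units_mul_neighbours]
  refine ⟨fun h δ => ⟨by simpa using h.zero, ?_, fun m => ?_⟩, fun h => ?_⟩
  · rcases Int.units_eq_one_or δ with rfl | rfl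
    · simpa using h.one
    · simpa using h.neg_one
  · exact_mod_cast (hrec δ m).1 (h.recursion _)
  · have h0 : ρ 0 = 1 := by simpa using (h 1).zero
    have h1 : ρ 1 = 1 := by simpa using (h 1).one
    have h_neg : ρ (-1) = 1 := by simpa using (h (-1)).one
    refine ⟨h0, h1, h_neg, fun n => ?_⟩
    obtain ⟨δ, m, rfl⟩ := exists_eq_units_mul_natCast n
    rcases m with _ | m
    · simp [bilinear, parityFactor, h0, h1, h_neg]
    · exact_mod_cast (hrec δ m).2 (by exact_mod_cast (h δ).recursion m)

/-- The sign in the symmetry `ρ_{δ n}(s) = ± ρ_n(δ s)` for `δ = ±1`. -/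
noncomputable def reflectionSign (δ : ℤˣ) (n : ℕ) : ℂ :=
  if Even n then ((δ : ℤ) : ℂ) ^ (n / 2) else 1

/-- The half `ρ_0, ρ_δ, ρ_{2δ}, …` obtained by reflection from the half `ρ_0, ρ_1, ρ_2, …`. -/
noncomputable def reflect (δ : ℤˣ) (σ : ℕ → ℂ[X]) (n : ℕ) : ℂ[X] :=
  C (reflectionSign δ n) * (σ n).comp (C ((δ : ℤ) : ℂ) * X)

lemma reflectionSign_two_mul (δ : ℤˣ) (k : ℕ) :
    reflectionSign δ (2 * k) = ((δ : ℤ) : ℂ) ^ k := by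
  rw [reflectionSign, if_pos (even_two_mul k), Nat.mul_div_cancel_left k two_pos]

lemma reflectionSign_two_mul_add_one (δ : ℤˣ) (k : ℕ) : reflectionSign δ (2 * k + 1) = 1 := by
  rw [reflectionSign, if_neg (Nat.not_even_two_mul_add_one k)]

lemma reflectionSign_sq (δ : ℤˣ) (n : ℕ) : reflectionSign δ n ^ 2 = 1 := by
  unfold reflectionSign
  split_ifs
  · rw [pow_right_comm, sq, units_cast_mul_self, one_pow]
  · exact one_pow 2

lemma reflectionSign_mul (δ : ℤˣ) (n : ℕ) :
    reflectionSign δ n * reflectionSign δ (n + 2) = ((δ : ℤ) : ℂ) ^ (n % 2 + 1) := by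
  unfold reflectionSign
  rcases Nat.mod_two_eq_zero_or_one n with hn | hn
  · rw [if_pos (Nat.even_iff.2 hn), if_pos (Nat.even_iff.2 (by omega)), hn,
      Nat.add_div_right n two_pos, pow_succ, ← mul_assoc, ← mul_pow, units_cast_mul_self, one_pow,
      one_mul, zero_add, pow_one]
  · rw [if_neg (by rw [Nat.even_iff]; omega), if_neg (by rw [Nat.even_iff]; omega), hn, sq,
      units_cast_mul_self, one_mul]

lemma IsHalfSequence.reflect (hσ : IsHalfSequence 1 σ) (δ : ℤˣ) :
    IsHalfSequence ((δ : ℤ) : ℂ) (reflect δ σ) where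
  zero := by simp [Ohyama.reflect, reflectionSign, hσ.zero]
  one := by simp [Ohyama.reflect, reflectionSign, hσ.one]
  recursion m := by
    have hrec := hσ.recursion m
    rw [one_mul] at hrec
    have hsign : C (reflectionSign δ m) * C (reflectionSign δ (m + 2)) =
        C ((δ : ℤ) : ℂ) ^ (m % 2 + 1) := by
      rw [← C_mul, reflectionSign_mul, C_pow]
    simp only [Ohyama.reflect]
    rw [todaForm_C_mul, ← C_pow, reflectionSign_sq, C_1, one_mul,
      todaForm_comp_C_mul_X (units_cast_mul_self δ), hrec, mul_comp, mul_comp, pow_comp, X_comp,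
      mul_mul_mul_comm (C _), hsign]
    ring

lemma reflect_ne_zero (hne : ∀ m, σ m ≠ 0) (δ : ℤˣ) (m : ℕ) : reflect δ σ m ≠ 0 := by
  refine mul_ne_zero (C_ne_zero.2 fun h => ?_) ?_
  · simpa [h] using reflectionSign_sq δ m
  · rw [Ne, comp_C_mul_X_eq_zero_iff (mem_nonZeroDivisors_of_ne_zero ?_)]
    · exact hne m
    · exact left_ne_zero_of_mul_eq_one (units_cast_mul_self δ)

section Ohyama

variable (hσ : IsHalfSequence 1 σ) (hne : ∀ m, σ m ≠ 0)

include hσ hne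

lemma IsHalfSequence.half_eq_reflect (δ : ℤˣ) (m : ℕ) : half δ m = Ohyama.reflect δ σ m :=
  (hσ.reflect δ).half_eq (fun m _ => reflect_ne_zero hne δ m) m

lemma IsHalfSequence.isOhyamaSequence_ohyama : IsOhyamaSequence ohyama := by
  refine isOhyamaSequence_iff.2 fun δ => ?_
  simp only [ohyama_units_mul, hσ.half_eq_reflect hne]
  exact hσ.reflect δ

lemma IsHalfSequence.eq_ohyama {ρ : ℤ → ℂ[X]} (hρ : IsOhyamaSequence ρ) : ρ = ohyama := by
  funext n
  obtain ⟨δ, m, rfl⟩ := exists_eq_units_mul_natCast n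
  rw [ohyama_units_mul]
  refine ((isOhyamaSequence_iff.1 hρ δ).half_eq (fun m hm => ?_) m).symm
  rw [← hm, hσ.half_eq_reflect hne]
  exact reflect_ne_zero hne δ m

end Ohyama

end Sequence

section Coefficients

variable {A B : ℤ → ℤ → ℝ}

lemma three_rpow_one_div_four : (3 : ℝ) ^ (1 / 4 : ℝ) = √√3 := by
  rw [Real.sqrt_eq_rpow, Real.sqrt_eq_rpow, ← Real.rpow_mul zero_le_three]
  norm_num

lemma coeffNat_zero_zero : coeffNat 0 0 = √√3 := by
  rw [coeffNat, if_pos rfl, three_rpow_one_div_four]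

lemma coeffNat_of_lt {m k : ℕ} (h : 2 * m < k) : coeffNat m k = 0 := by
  rcases m with _ | m
  · rw [coeffNat, if_neg (by omega)]
  · rw [coeffNat, if_pos (Or.inr h)]

lemma coeffNat_diagonal (m : ℕ) : coeffNat m (2 * m) =
    (3 * √3 / 2) ^ m * ((3 : ℝ) ^ (1 / 4 : ℝ) / (m.factorial : ℝ)) := by
  rcases m with _ | m
  · simp [coeffNat]
  · rw [coeffNat, if_neg (by omega), if_pos rfl]

lemma coeffNat_recursion (m : ℕ) {k : ℕ} (hk : k ≠ 0) :
    ((k : ℝ) + 1) / 3 * coeffNat (m + 1) (k + 1) - coeffNat (m + 1) k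
      + 3 * √3 / (k : ℝ) * (if k < 2 then 0 else coeffNat m (k - 2)) = 0 := by
  rcases lt_trichotomy k (2 * (m + 1)) with h | rfl | h
  · rw [coeffNat.eq_2 k m, if_neg (by omega), if_neg (by omega)]
    ring
  · rw [coeffNat_diagonal, coeffNat_of_lt (by omega), if_neg (by omega), Nat.mul_add_one,
      Nat.add_sub_cancel, coeffNat_diagonal, Nat.factorial_succ]
    push_cast
    field_simp
    ring
  · rw [coeffNat_of_lt h, coeffNat_of_lt (by omega), if_neg (by omega),
      coeffNat_of_lt (by omega)]
    ring

lemma coeff_natCast (m k : ℕ) : coeff m k = coeffNat m k := by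
  simp [coeff]

lemma coeff_of_neg {m k : ℤ} (h : m < 0 ∨ k < 0) : coeff m k = 0 :=
  if_neg (by omega)

lemma coeff_natCast_sub_two (m k : ℕ) :
    coeff m (k - 2) = if k < 2 then 0 else coeffNat m (k - 2) := by
  split_ifs with hk
  · exact coeff_of_neg (Or.inr (by omega))
  · rw [← coeff_natCast, Nat.cast_sub (not_lt.1 hk), Nat.cast_ofNat]

lemma coeff_recursion (m : ℤ) {k : ℤ} (hk : k ≠ 0) :
    ((k : ℝ) + 1) / 3 * coeff m (k + 1) - coeff m k
      + 3 * √3 / (k : ℝ) * coeff (m - 1) (k - 2) = 0 := by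
  rcases lt_or_ge k 0 with hk_neg | hk_nonneg
  · have hsucc : ((k : ℝ) + 1) * coeff m (k + 1) = 0 := by
      rcases eq_or_ne k (-1) with rfl | hk_ne
      · simp
      · rw [coeff_of_neg (Or.inr (by omega)), mul_zero]
    rw [coeff_of_neg (Or.inr hk_neg), coeff_of_neg (k := k - 2) (Or.inr (by omega))]
    linear_combination hsucc / 3
  lift k to ℕ using hk_nonneg
  have hk_nat : k ≠ 0 := by exact_mod_cast hk
  rcases le_or_gt m 0 with hm | hm
  · have hrow {l : ℤ} (hl : 0 < l) : coeff m l = 0 := by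
      rcases hm.lt_or_eq with hm | rfl
      · exact coeff_of_neg (Or.inl hm)
      · lift l to ℕ using hl.le
        exact (coeff_natCast 0 l).trans (coeffNat_of_lt (by omega))
    rw [hrow (by omega), hrow (by omega), coeff_of_neg (Or.inl (by omega))]
    ring
  · obtain ⟨m, rfl⟩ : ∃ l : ℕ, m = (l + 1 : ℕ) := ⟨(m - 1).toNat, by omega⟩
    have hm_pred : ((m + 1 : ℕ) : ℤ) - 1 = m := by simp
    have hk_succ : (k : ℤ) + 1 = (k + 1 : ℕ) := by simp
    rw [hm_pred, hk_succ, coeff_natCast, coeff_natCast, coeff_natCast_sub_two]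
    simpa only [Int.cast_natCast] using coeffNat_recursion m hk_nat

lemma isEntryCoeff_coeff : IsEntryCoeff coeff where
  support m k h := by
    contrapose! h
    exact coeff_of_neg (by omega)
  recursion m _ hk := coeff_recursion m hk
  diagonal m := by exact_mod_cast (coeff_natCast m (2 * m)).trans (coeffNat_diagonal m)
  left m hm := by
    obtain ⟨m, rfl⟩ : ∃ l : ℕ, m = (l + 1 : ℕ) := ⟨(m - 1).toNat, by omega⟩
    exact (coeff_natCast (m + 1) 0).trans (by rw [coeffNat, if_pos (Or.inl rfl)])
  bottom k hk := by
    lift k to ℕ using by omega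
    exact (coeff_natCast 0 k).trans (coeffNat_of_lt (by omega))

lemma eq_zero_of_row_recursion {d : ℕ → ℝ}
    (hrec : ∀ k : ℕ, k ≠ 0 → ((k : ℝ) + 1) / 3 * d (k + 1) = d k) (h0 : d 0 = 0) {l : ℕ}
    (hl : l ≠ 0) (hdl : d l = 0) : ∀ k, d k = 0 := by
  have hiff (k : ℕ) : d (k + 1) = 0 ↔ d 1 = 0 := by
    induction k with
    | zero => rfl
    | succ k ih =>
      have hfactor : ((k + 1 : ℕ) + 1 : ℝ) / 3 ≠ 0 := by positivity
      rw [← ih, ← hrec (k + 1) k.succ_ne_zero, mul_eq_zero_iff_left hfactor]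
  obtain ⟨l, rfl⟩ := Nat.exists_eq_succ_of_ne_zero hl
  rintro (_ | k)
  · exact h0
  · exact (hiff k).2 ((hiff l).1 hdl)

namespace IsEntryCoeff

lemma eq_zero_of_neg (hA : IsEntryCoeff A) {m k : ℤ} (h : m < 0 ∨ k < 0) : A m k = 0 := by
  contrapose! h
  exact hA.support m k h

lemma row_eq (hA : IsEntryCoeff A) (hB : IsEntryCoeff B) {m : ℕ}
    (hprev : ∀ k, A (m - 1) k = B (m - 1) k) (k : ℕ) : A m k = B m k := by
  rcases m with _ | m
  · rcases k with _ | k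
    · simpa using (hA.diagonal 0).trans (hB.diagonal 0).symm
    · exact (hA.bottom _ (by simp)).trans (hB.bottom _ (by simp)).symm
  refine sub_eq_zero.1 (eq_zero_of_row_recursion
    (d := fun k : ℕ => A (m + 1 : ℕ) k - B (m + 1 : ℕ) k) (fun k hk => ?_)
    (sub_eq_zero.2 ((hA.left _ (by simp)).trans (hB.left _ (by simp)).symm))
    (l := 2 * (m + 1)) (by omega) (sub_eq_zero.2 ?_) k)
  · have hk' : (k : ℤ) ≠ 0 := by exact_mod_cast hk
    have hrecA := hA.recursion (m + 1 : ℕ) k hk'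
    have hrecB := hB.recursion (m + 1 : ℕ) k hk'
    rw [hprev] at hrecA
    push_cast at hrecA hrecB ⊢
    linear_combination hrecA - hrecB
  · exact_mod_cast (hA.diagonal (m + 1)).trans (hB.diagonal (m + 1)).symm

lemma ext (hA : IsEntryCoeff A) (hB : IsEntryCoeff B) : A = B := by
  have hneg {m k : ℤ} (h : m < 0 ∨ k < 0) : A m k = B m k := by
    rw [hA.eq_zero_of_neg h, hB.eq_zero_of_neg h]
  have hrow (m : ℕ) (k : ℤ) : A m k = B m k := by
    induction m generalizing k with
    | zero =>
      rcases lt_or_ge k 0 with hk | hk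
      · exact hneg (Or.inr hk)
      · lift k to ℕ using hk
        exact hA.row_eq hB (fun k => hneg (Or.inl (by simp))) k
    | succ m ih =>
      rcases lt_or_ge k 0 with hk | hk
      · exact hneg (Or.inr hk)
      · lift k to ℕ using hk
        exact hA.row_eq hB (fun k => by simpa using ih k) k
  funext m k
  rcases lt_or_ge m 0 with hm | hm
  · exact hneg (Or.inl hm)
  · lift m to ℕ using hm
    exact hrow m k

lemma recursion_mul (hA : IsEntryCoeff A) (m k : ℤ) :
    (k : ℝ) * (k + 1) / 3 * A m (k + 1) - k * A m k + 3 * √3 * A (m - 1) (k - 2) = 0 := by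
  rcases eq_or_ne k 0 with rfl | hk
  · rw [hA.eq_zero_of_neg (k := 0 - 2) (Or.inr (by simp))]
    simp
  · have hk' : (k : ℝ) ≠ 0 := by exact_mod_cast hk
    have hrec := hA.recursion m k hk
    field_simp at hrec ⊢
    linear_combination hrec

end IsEntryCoeff

end Coefficients

section EntryPolynomials

/-- The Wronskian entry `W_{j+1}`, as a polynomial in `s`. -/
noncomputable def entryPoly (j : ℕ) : ℂ[X] :=
  ∑ k ∈ Finset.range (2 * j + 1), monomial k ((coeff j k : ℂ) / 3 ^ k)

/-- The rescaling of the polynomials `entryPoly j` that starts at `1` and satisfies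
`p_{j+1}'' - p_{j+1}' = -s p_j`. -/
noncomputable def entryChain (j : ℕ) : ℂ[X] :=
  C ((√3 : ℂ) ^ j / (√√3 : ℂ)) * entryPoly j

lemma coeff_entryPoly (j k : ℕ) : (entryPoly j).coeff k = (coeff j k : ℂ) / 3 ^ k := by
  rw [entryPoly, finsetSum_coeff]
  simp only [coeff_monomial]
  rw [Finset.sum_ite_eq', ite_eq_left_iff, Finset.mem_range, not_lt]
  intro hk
  rw [coeff_natCast, coeffNat_of_lt hk, Complex.ofReal_zero, zero_div]

lemma entryPoly_zero : entryPoly 0 = C (√√3 : ℂ) := by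
  have h : coeff 0 0 = √√3 := (coeff_natCast 0 0).trans coeffNat_zero_zero
  simp [entryPoly, h]

lemma coeff_X_mul_entryPoly (j k : ℕ) :
    (X * entryPoly j).coeff k = 3 * (coeff j (k - 1) : ℂ) / 3 ^ k := by
  rcases k with _ | k
  · simp [coeff_of_neg]
  · rw [coeff_X_mul, coeff_entryPoly, Nat.cast_succ, add_sub_cancel_right, pow_succ]
    field_simp

lemma ofReal_sqrt_three_sq : (√3 : ℂ) ^ 2 = 3 := by
  exact_mod_cast Real.sq_sqrt zero_le_three

lemma ofReal_sqrt_sqrt_three_sq : (√√3 : ℂ) ^ 2 = √3 := by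
  exact_mod_cast Real.sq_sqrt (Real.sqrt_nonneg 3)

lemma ofReal_sqrt_three_ne_zero : (√3 : ℂ) ≠ 0 := by
  exact_mod_cast Real.sqrt_ne_zero'.2 zero_lt_three

lemma ofReal_sqrt_sqrt_three_ne_zero : (√√3 : ℂ) ≠ 0 := by
  exact_mod_cast Real.sqrt_ne_zero'.2 (Real.sqrt_pos.2 zero_lt_three)

lemma derivative_derivative_entryPoly_succ (j : ℕ) :
    C (√3 : ℂ) * (derivative (derivative (entryPoly (j + 1))) - derivative (entryPoly (j + 1))) =
      -X * entryPoly j := by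
  ext k
  have hrec := congrArg ((↑) : ℝ → ℂ) (isEntryCoeff_coeff.recursion_mul (j + 1 : ℕ) (k + 1 : ℕ))
  rw [neg_mul, coeff_neg, coeff_X_mul_entryPoly, coeff_C_mul, coeff_sub, coeff_derivative,
    coeff_derivative, coeff_derivative, coeff_entryPoly, coeff_entryPoly]
  have h1 : ((j + 1 : ℕ) : ℤ) - 1 = j := by simp
  have h2 : ((k + 1 : ℕ) : ℤ) - 2 = k - 1 := by push_cast; ring
  rw [h1, h2] at hrec
  push_cast at hrec ⊢
  linear_combination ((√3 : ℂ) / 3 ^ (k + 1)) * hrec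
    - (3 * (coeff j (k - 1) : ℂ) / 3 ^ (k + 1)) * ofReal_sqrt_three_sq

lemma isChain_entryChain : IsChain entryChain where
  zero := by
    rw [entryChain, entryPoly_zero, ← C_mul, pow_zero,
      one_div_mul_cancel ofReal_sqrt_sqrt_three_ne_zero, C_1]
  succ j := by
    have hsucc := derivative_derivative_entryPoly_succ j
    simp only [entryChain, derivative_C_mul]
    simp only [pow_succ, div_eq_mul_inv, C_mul]
    linear_combination (C ((√3 : ℂ) ^ j) * C (√√3 : ℂ)⁻¹) * hsucc

end EntryPolynomials

section ChangeOfVariable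

variable {s φ : ℂ → ℂ} {U : Set ℂ}

/-- The coefficients in the `i`-th derivative of a composition `f ∘ s` with `s' = φ`:
`(f ∘ s)⁽ⁱ⁾ = ∑ₖ chainCoeff φ i k * (f⁽ᵏ⁾ ∘ s)`. -/
noncomputable def chainCoeff (φ : ℂ → ℂ) : ℕ → ℕ → ℂ → ℂ
  | 0, 0 => 1
  | 0, _ + 1 => 0
  | i + 1, 0 => deriv (chainCoeff φ i 0)
  | i + 1, k + 1 => deriv (chainCoeff φ i (k + 1)) + φ * chainCoeff φ i k

lemma chainCoeff_of_lt : ∀ {i k : ℕ}, i < k → chainCoeff φ i k = 0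
  | 0, _ + 1, _ => rfl
  | i + 1, k + 1, h => by
    rw [chainCoeff, chainCoeff_of_lt (by omega), chainCoeff_of_lt (by omega), mul_zero, add_zero]
    exact deriv_const' 0

lemma chainCoeff_self : ∀ i : ℕ, chainCoeff φ i i = φ ^ i
  | 0 => rfl
  | i + 1 => by
    have hderiv : deriv (0 : ℂ → ℂ) = 0 := deriv_const' 0
    rw [chainCoeff, chainCoeff_of_lt i.lt_succ_self, hderiv, zero_add, chainCoeff_self i,
      pow_succ']

lemma differentiableOn_chainCoeff (hU : IsOpen U) (hφ : DifferentiableOn ℂ φ U) :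
    ∀ i k : ℕ, DifferentiableOn ℂ (chainCoeff φ i k) U
  | 0, 0 => differentiableOn_const 1
  | 0, _ + 1 => differentiableOn_const 0
  | i + 1, 0 => (differentiableOn_chainCoeff hU hφ i 0).deriv hU
  | i + 1, k + 1 => ((differentiableOn_chainCoeff hU hφ i (k + 1)).deriv hU).add
      (hφ.mul (differentiableOn_chainCoeff hU hφ i k))

lemma iteratedDeriv_eval_comp (hU : IsOpen U) (hs : ∀ z ∈ U, HasDerivAt s (φ z) z)
    (hφ : DifferentiableOn ℂ φ U) (f : ℂ[X]) (i : ℕ) {z : ℂ} (hz : z ∈ U) :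
    iteratedDeriv i (fun z => f.eval (s z)) z =
      ∑ k ∈ Finset.range (i + 1), chainCoeff φ i k z * (derivative^[k] f).eval (s z) := by
  induction i generalizing z with
  | zero => simp [chainCoeff]
  | succ i ih =>
    have hterm (k : ℕ) : HasDerivAt (fun z => chainCoeff φ i k z * (derivative^[k] f).eval (s z))
        (deriv (chainCoeff φ i k) z * (derivative^[k] f).eval (s z)
          + φ z * chainCoeff φ i k z * (derivative^[k + 1] f).eval (s z)) z := by
      rw [Function.iterate_succ_apply', mul_comm (φ z), mul_assoc, mul_comm (φ z)]
      exact ((differentiableOn_chainCoeff hU hφ i k).differentiableAt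
        (hU.mem_nhds hz)).hasDerivAt.mul (((derivative^[k] f).hasDerivAt (s z)).comp z (hs z hz))
    have hlast : deriv (chainCoeff φ i (i + 1)) z = 0 := by
      rw [chainCoeff_of_lt i.lt_succ_self]
      exact deriv_const z 0
    have hnear := Filter.eventuallyEq_of_mem (hU.mem_nhds hz) fun y hy => ih hy
    rw [iteratedDeriv_succ, hnear.deriv_eq,
      (HasDerivAt.fun_sum fun k _ => hterm k).deriv, Finset.sum_add_distrib,
      Finset.sum_range_succ' _ (i + 1)]
    simp only [chainCoeff, Pi.add_apply, Pi.mul_apply, add_mul, Finset.sum_add_distrib]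
    rw [add_right_comm, ← Finset.sum_range_succ' (fun k => deriv (chainCoeff φ i k) z *
      (derivative^[k] f).eval (s z)), Finset.sum_range_succ _ (i + 1), hlast, zero_mul, add_zero]

lemma wronskian_eval_comp (hU : IsOpen U) (hs : ∀ z ∈ U, HasDerivAt s (φ z) z)
    (hφ : DifferentiableOn ℂ φ U) (q : ℕ → ℂ[X]) (N : ℕ) {z : ℂ} (hz : z ∈ U) :
    wronskian (fun (j : Fin N) z => (q j).eval (s z)) z =
      (∏ i ∈ Finset.range N, φ z ^ i) * (polyWronskian q N).eval (s z) := by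
  set L : Matrix (Fin N) (Fin N) ℂ := Matrix.of fun i k => chainCoeff φ i k z with hL
  set P : Matrix (Fin N) (Fin N) ℂ :=
    Matrix.of fun k j => (derivative^[k] (q j)).eval (s z) with hP
  have hfactor : (Matrix.of fun i j : Fin N => iteratedDeriv i (fun z => (q j).eval (s z)) z) =
      L * P := by
    ext i j
    simp only [Matrix.of_apply, Matrix.mul_apply, hL, hP]
    rw [iteratedDeriv_eval_comp hU hs hφ (q j) i hz, ← Finset.sum_range
      (fun k => chainCoeff φ i k z * (derivative^[k] (q j)).eval (s z))]
    refine Finset.sum_subset (Finset.range_subset_range.2 i.2) fun k _ hk => ?_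
    rw [chainCoeff_of_lt (by simpa using hk), Pi.zero_apply, zero_mul]
  have hdetL : L.det = ∏ i ∈ Finset.range N, φ z ^ i := by
    rw [Matrix.det_of_isLowerTriangular L fun i k hik => congrFun (chainCoeff_of_lt hik) z,
      Finset.prod_range]
    exact Finset.prod_congr rfl fun i _ => congrFun (chainCoeff_self (i : ℕ)) z
  have hdetP : P.det = (polyWronskian q N).eval (s z) := by
    rw [polyWronskian, ← coe_evalRingHom, RingHom.map_det]
    rfl
  rw [wronskian, hfactor, Matrix.det_mul, hdetL, hdetP]

end ChangeOfVariable

section SVariable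

/-- The cube root `t` of `z / 2`, in terms of which `s = 3 t²` and `ds/dz = 1 / t`. -/
noncomputable def cubeRoot (z : ℂ) : ℂ := (z / 2) ^ (1 / 3 : ℂ)

variable {z : ℂ}

lemma div_two_mem_slitPlane (hz : z ∈ Complex.slitPlane) : z / 2 ∈ Complex.slitPlane := by
  rw [Complex.mem_slitPlane_iff] at hz ⊢
  simpa using hz

lemma cubeRoot_ne_zero (hz : z ∈ Complex.slitPlane) : cubeRoot z ≠ 0 :=
  Complex.cpow_ne_zero_iff.2 (Or.inl (Complex.slitPlane_ne_zero (div_two_mem_slitPlane hz)))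

lemma sVar_eq_cubeRoot_sq (z : ℂ) : sVar z = 3 * cubeRoot z ^ 2 := by
  rw [sVar, cubeRoot, ← Complex.cpow_nat_mul]
  norm_num

lemma hasDerivAt_sVar (hz : z ∈ Complex.slitPlane) : HasDerivAt sVar (cubeRoot z)⁻¹ z := by
  refine ((((hasDerivAt_id z).div_const 2).cpow_const (c := (2 / 3 : ℂ))
    (div_two_mem_slitPlane hz)).const_mul 3).congr_deriv ?_
  rw [cubeRoot, ← Complex.cpow_neg]
  norm_num
  ring

lemma differentiableOn_inv_cubeRoot :
    DifferentiableOn ℂ (fun z => (cubeRoot z)⁻¹) Complex.slitPlane := fun z hz =>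
  (((hasDerivAt_id z).div_const 2).cpow_const (c := (1 / 3 : ℂ))
    (div_two_mem_slitPlane hz)).differentiableAt.differentiableWithinAt.inv (cubeRoot_ne_zero hz)

lemma sVar_div_three_cpow (z : ℂ) (k : ℕ) : (sVar z / 3) ^ ((k : ℂ) / 2) = cubeRoot z ^ k := by
  have him : (Complex.log (z / 2) * (2 / 3)).im = (z / 2).arg * (2 / 3) := by
    have hreal : (2 / 3 : ℂ) = ((2 / 3 : ℝ) : ℂ) := by push_cast; rfl
    rw [hreal, Complex.im_mul_ofReal, Complex.log_im]
  have hgt : -Real.pi < (Complex.log (z / 2) * (2 / 3)).im := by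
    linarith [Complex.neg_pi_lt_arg (z / 2), Real.pi_pos]
  have hle : (Complex.log (z / 2) * (2 / 3)).im ≤ Real.pi := by
    linarith [Complex.arg_le_pi (z / 2), Real.pi_pos]
  rw [sVar, mul_div_cancel_left₀ _ three_ne_zero, ← Complex.cpow_mul _ hgt hle, cubeRoot,
    ← Complex.cpow_nat_mul]
  congr 1
  ring

end SVariable

section Entries

variable {z : ℂ}

lemma entry_units_mul (δ : ℤˣ) (j : ℕ) (z : ℂ) :
    entry (δ * (j + 1)) z = (entryPoly j).eval ((δ : ℤ) * sVar z) := by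
  have habs : |(δ : ℤ) * (j + 1 : ℕ)| = (j + 1 : ℕ) := by
    rw [Int.abs_eq_natAbs, natAbs_units_mul]
  rw [← Nat.cast_succ, entry, habs, natAbs_units_mul, sign_units_mul j.succ_ne_zero, entryPoly,
    eval_finsetSum]
  refine Finset.sum_congr rfl fun k _ => ?_
  rw [eval_monomial, Nat.cast_succ, add_sub_cancel_right, div_pow]
  ring

lemma entryWronskian_units_mul (δ : ℤˣ) (N : ℕ) (hz : z ∈ Complex.slitPlane) :
    entryWronskian (δ * N) z = (∏ i ∈ Finset.range N, ((δ : ℤ) * (cubeRoot z)⁻¹) ^ i) *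
      (polyWronskian entryPoly N).eval ((δ : ℤ) * sVar z) := by
  rw [← wronskian_eval_comp Complex.isOpen_slitPlane
    (fun z hz => (hasDerivAt_sVar hz).const_mul ((δ : ℤ) : ℂ))
    (differentiableOn_inv_cubeRoot.const_mul ((δ : ℤ) : ℂ)) entryPoly N hz]
  rw [entryWronskian, natAbs_units_mul]
  refine congrArg (wronskian · z) (funext fun j => ?_)
  rw [sign_units_mul j.pos.ne']
  exact funext (entry_units_mul δ j)

lemma entryPoly_eq (j : ℕ) : entryPoly j = C (√√3 * (√3 : ℂ)⁻¹ ^ j) * entryChain j := by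
  have hscale : (√√3 * (√3 : ℂ)⁻¹ ^ j) * ((√3 : ℂ) ^ j / √√3) = 1 := by
    have h1 := ofReal_sqrt_three_ne_zero
    have h2 := ofReal_sqrt_sqrt_three_ne_zero
    rw [inv_pow]
    field_simp
  rw [entryChain, ← mul_assoc, ← C_mul, hscale, C_1, one_mul]

lemma eval_polyWronskian_entryPoly (N : ℕ) (s : ℂ) :
    (polyWronskian entryPoly N).eval s =
      (∏ j ∈ Finset.range N, √√3 * (√3 : ℂ)⁻¹ ^ j * s ^ (j / 2)) *
        (reducedWronskian entryChain N).eval s := by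
  rw [funext entryPoly_eq, polyWronskian_C_mul, isChain_entryChain.polyWronskian_eq,
    eval_C_mul, eval_mul, eval_X_pow, ← mul_assoc, wronskianOrder,
    ← Finset.prod_pow_eq_pow_sum, ← Finset.prod_mul_distrib]

lemma prod_range_two_mul {R : Type*} [CommSemiring R] (a : R) {u y : R} (h : (u ^ 2 * y) ^ 2 = 1)
    (k : ℕ) : ∏ j ∈ Finset.range (2 * k), a * u ^ j * y ^ (j / 2) = (a ^ 2 * u) ^ k := by
  induction k with
  | zero => simp
  | succ k ih =>
    have hdiv : (2 * k + 1) / 2 = k := by omega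
    rw [Nat.mul_succ, Finset.prod_range_succ, Finset.prod_range_succ, ih, hdiv,
      Nat.mul_div_cancel_left k two_pos]
    calc (a ^ 2 * u) ^ k * (a * u ^ (2 * k) * y ^ k) * (a * u ^ (2 * k + 1) * y ^ k)
        = (a ^ 2 * u) ^ (k + 1) * ((u ^ 2 * y) ^ 2) ^ k := by
          ring
      _ = (a ^ 2 * u) ^ (k + 1) := by rw [h, one_pow, mul_one]

lemma entryWronskian_eq_prod_mul (δ : ℤˣ) (N : ℕ) (hz : z ∈ Complex.slitPlane) :
    entryWronskian (δ * N) z =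
      (∏ j ∈ Finset.range N, √√3 * ((δ : ℤ) * (cubeRoot z * √3)⁻¹) ^ j *
        ((δ : ℤ) * sVar z) ^ (j / 2)) *
        (reducedWronskian entryChain N).eval ((δ : ℤ) * sVar z) := by
  rw [entryWronskian_units_mul δ N hz, eval_polyWronskian_entryPoly, ← mul_assoc,
    ← Finset.prod_mul_distrib]
  congr 1
  refine Finset.prod_congr rfl fun j _ => ?_
  rw [mul_inv, ← mul_assoc ((δ : ℤ) : ℂ), mul_pow _ (√3 : ℂ)⁻¹]
  ring

lemma sq_mul_sVar (δ : ℤˣ) (hz : z ∈ Complex.slitPlane) :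
    ((δ : ℤ) * (cubeRoot z * √3)⁻¹ : ℂ) ^ 2 * ((δ : ℤ) * sVar z) = (δ : ℤ) := by
  have ht := cubeRoot_ne_zero hz
  have h3 := ofReal_sqrt_three_ne_zero
  rw [sVar_eq_cubeRoot_sq]
  field_simp
  linear_combination 3 * units_cast_mul_self δ - ofReal_sqrt_three_sq

lemma sqrt_three_mul_inv (δ : ℤˣ) (z : ℂ) :
    (√√3 : ℂ) ^ 2 * ((δ : ℤ) * (cubeRoot z * √3)⁻¹) = (δ : ℤ) * (cubeRoot z)⁻¹ := by
  rw [ofReal_sqrt_sqrt_three_sq, mul_inv]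
  linear_combination ((δ : ℤ) * (cubeRoot z)⁻¹) * mul_inv_cancel₀ ofReal_sqrt_three_ne_zero

lemma sq_mul_sVar_sq (δ : ℤˣ) (hz : z ∈ Complex.slitPlane) :
    (((δ : ℤ) * (cubeRoot z * √3)⁻¹ : ℂ) ^ 2 * ((δ : ℤ) * sVar z)) ^ 2 = 1 := by
  rw [sq_mul_sVar δ hz, sq, units_cast_mul_self]

lemma entryWronskian_two_mul (δ : ℤˣ) (k : ℕ) (hz : z ∈ Complex.slitPlane) :
    entryWronskian (δ * (2 * k : ℕ)) z = ((δ : ℤ) * (cubeRoot z)⁻¹) ^ k *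
      (reducedWronskian entryChain (2 * k)).eval ((δ : ℤ) * sVar z) := by
  rw [entryWronskian_eq_prod_mul δ _ hz, prod_range_two_mul _ (sq_mul_sVar_sq δ hz),
    sqrt_three_mul_inv]

lemma entryWronskian_two_mul_add_one (δ : ℤˣ) (k : ℕ) (hz : z ∈ Complex.slitPlane) :
    entryWronskian (δ * (2 * k + 1 : ℕ)) z = √√3 * (cubeRoot z)⁻¹ ^ k *
      (reducedWronskian entryChain (2 * k + 1)).eval ((δ : ℤ) * sVar z) := by
  have hδ : ((δ : ℤ) : ℂ) ^ k * (δ : ℤ) ^ k = 1 := by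
    rw [← mul_pow, units_cast_mul_self, one_pow]
  rw [entryWronskian_eq_prod_mul δ _ hz, Finset.prod_range_succ,
    prod_range_two_mul _ (sq_mul_sVar_sq δ hz), sqrt_three_mul_inv,
    Nat.mul_div_cancel_left k two_pos, mul_assoc (√√3 : ℂ), pow_mul, ← mul_pow,
    sq_mul_sVar δ hz, mul_pow]
  linear_combination (√√3 * (cubeRoot z)⁻¹ ^ k *
    (reducedWronskian entryChain (2 * k + 1)).eval ((δ : ℤ) * sVar z)) * hδ

lemma ohyama_units_mul_eq_reflect (δ : ℤˣ) (N : ℕ) :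
    ohyama (δ * N) = reflect δ (reducedWronskian entryChain) N := by
  rw [ohyama_units_mul, isChain_entryChain.isHalfSequence_reducedWronskian.half_eq_reflect
    isChain_entryChain.reducedWronskian_ne_zero]

lemma eval_reflect (δ : ℤˣ) (σ : ℕ → ℂ[X]) (N : ℕ) (s : ℂ) :
    (reflect δ σ N).eval s = reflectionSign δ N * (σ N).eval ((δ : ℤ) * s) := by
  rw [reflect, eval_C_mul, eval_comp, eval_C_mul, eval_X]

lemma three_cpow_neg_one_div_four : (3 : ℂ) ^ (-(1 / 4) : ℂ) = (√√3 : ℂ)⁻¹ := by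
  rw [Complex.cpow_neg, ← three_rpow_one_div_four, Complex.ofReal_cpow zero_le_three]
  norm_num

lemma eval_ohyama_of_odd {n : ℤ} (hn : Odd n) (hz : z ∈ Complex.slitPlane) :
    (ohyama n).eval (sVar z) = (3 : ℂ) ^ (-(1 / 4) : ℂ) *
      (sVar z / 3) ^ (((|n| : ℤ) - 1 : ℂ) / 4) * entryWronskian n z := by
  obtain ⟨δ, N, rfl⟩ := exists_eq_units_mul_natCast n
  obtain ⟨k, rfl⟩ : Odd N := by simpa [natAbs_units_mul] using hn.natAbs
  have habs : ((|(δ : ℤ) * (2 * k + 1 : ℕ)| : ℤ) - 1 : ℂ) / 4 = k / 2 := by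
    rw [Int.abs_eq_natAbs, natAbs_units_mul]
    push_cast
    ring
  have ht := cubeRoot_ne_zero hz
  have hθ := ofReal_sqrt_sqrt_three_ne_zero
  rw [habs, sVar_div_three_cpow, three_cpow_neg_one_div_four, entryWronskian_two_mul_add_one δ k hz,
    ohyama_units_mul_eq_reflect, eval_reflect, reflectionSign_two_mul_add_one, inv_pow]
  field_simp

lemma eval_ohyama_of_even {n : ℤ} (hn : Even n) (hz : z ∈ Complex.slitPlane) :
    (ohyama n).eval (sVar z) =
      (sVar z / 3) ^ (((|n| : ℤ) : ℂ) / 4) * entryWronskian n z := by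
  obtain ⟨δ, N, rfl⟩ := exists_eq_units_mul_natCast n
  obtain ⟨k, rfl⟩ := even_iff_exists_two_mul.1 (by simpa [natAbs_units_mul] using hn.natAbs)
  have habs : ((|(δ : ℤ) * (2 * k : ℕ)| : ℤ) : ℂ) / 4 = k / 2 := by
    rw [Int.abs_eq_natAbs, natAbs_units_mul]
    push_cast
    ring
  have ht := cubeRoot_ne_zero hz
  rw [habs, sVar_div_three_cpow, entryWronskian_two_mul δ k hz, ohyama_units_mul_eq_reflect,
    eval_reflect, reflectionSign_two_mul, mul_pow, inv_pow]
  field_simp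

end Entries

end Ohyama

theorem theorem4p1 :
    (Ohyama.IsOhyamaSequence Ohyama.ohyama ∧
      ∀ ρ : ℤ → ℂ[X], Ohyama.IsOhyamaSequence ρ → ρ = Ohyama.ohyama) ∧
    (Ohyama.IsEntryCoeff Ohyama.coeff ∧
      ∀ A : ℤ → ℤ → ℝ, Ohyama.IsEntryCoeff A → A = Ohyama.coeff) ∧
    ∀ n : ℤ, ∀ z ∈ Complex.slitPlane,
      (Odd n → (Ohyama.ohyama n).eval (Ohyama.sVar z) =
        (3 : ℂ) ^ (-(1 / 4) : ℂ) * (Ohyama.sVar z / 3) ^ (((|n| : ℤ) - 1 : ℂ) / 4)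
          * Ohyama.entryWronskian n z) ∧
      (Even n → (Ohyama.ohyama n).eval (Ohyama.sVar z) =
        (Ohyama.sVar z / 3) ^ (((|n| : ℤ) : ℂ) / 4) * Ohyama.entryWronskian n z) := by
  have hσ := Ohyama.isChain_entryChain.isHalfSequence_reducedWronskian
  have hne := Ohyama.isChain_entryChain.reducedWronskian_ne_zero
  exact ⟨⟨hσ.isOhyamaSequence_ohyama hne, fun _ hρ => hσ.eq_ohyama hne hρ⟩,
    ⟨Ohyama.isEntryCoeff_coeff, fun _ hA => hA.ext Ohyama.isEntryCoeff_coeff⟩,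
    fun _ _ hz => ⟨fun hn => Ohyama.eval_ohyama_of_odd hn hz,
      fun hn => Ohyama.eval_ohyama_of_even hn hz⟩⟩
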